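/- Let $N_j\to\infty$ be a sequence of block lengths and let $C_j\subseteq\{0,1\}^{N_j}$ be binary linear codes of dimension $k_j$ with rate $k_j/N_j\to R_c$. Let $\delta^\star$ be the erasure rate threshold of the sequence $(C_j)$ under some given family of decoders (which may depend on the erasure rate; for example maximum-likelihood decoding), i.e. the supremum of the erasure rates $\delta\in[0,1]$ such that the word (or bit) error probability of the decoders, for a uniformly distributed codeword of $C_j$ sent over the memoryless binary erasure channel with erasure rate $\delta$, tends to $0$ as $j\to\infty$. Let $C_j^{\perp}=\{x\in\{0,1\}^{N_j} : x\cdot y=0\ \text{for all } y\in C_j\}$ be the dual code. Consider the secure nested codes with fine code $\{0,1\}^{N_j}$ and coarse code $C_j^\perp$: a message $W$, uniformly distributed over the cosets of $C_j^\perp$ in $\{0,1\}^{N_j}$, is encoded as a uniformly random word $X$ of its coset. The legitimate receiver observes $X$ without noise and outputs its coset. Let $\lambda\ge 0$. The eavesdropper observes $Z$, the output of the memoryless channel with binary input $x\in\{1,-1\}$ (the symbol of a bit of $X$) and real output of law $\mathcal N(-x\sqrt{2\lambda},1)$. Let $Q(x)=\int_x^\infty \frac{1}{\sqrt{2\pi}}e^{-z^2/2}\,dz$.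 If $Q(\sqrt{2\lambda})\ge (1-\delta^\star)/2$, then this code sequence achieves the rate-equivocation pair $(R,R_e)=(R_c,R_c)$, i.e. perfect secrecy: the information rate of the $j$-th nested code (the binary logarithm of the number of messages, divided by $N_j$) equals $k_j/N_j$, and so tends to $R_c$; the error probability of the legitimate receiver tends to $0$; and the limit of the normalized equivocation $H(W\mid Z)/N_j$ (in bits) exists and is at least $R_c$. -/

import Mathlib

open Filter Topology

noncomputable section

namespace Wiretap

/-- Binary words of length `n`, i.e. `{0,1}ⁿ` as a vector space over the field with two elements. -/
abbrev BinWord (n : ℕ) : Type := Fin n → ZMod 2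

/-- A binary linear code of length `n`. -/
abbrev BinCode (n : ℕ) : Type := Submodule (ZMod 2) (BinWord n)

/-- The rate `k / n` of a binary linear code of length `n` and dimension `k`. -/
def codeRate {n : ℕ} (C : BinCode n) : ℝ := (Module.finrank (ZMod 2) C : ℝ) / n

/-- The dual code `{x | x · y = 0 for all y ∈ C}`. -/
def dualCode {n : ℕ} (C : BinCode n) : BinCode n where
  carrier := {x | ∀ y ∈ C, x ⬝ᵥ y = 0}
  add_mem' := by
    intro a b ha hb y hy
    rw [add_dotProduct, ha y hy, hb y hy, add_zero]
  zero_mem' := by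
    intro y _
    exact zero_dotProduct y
  smul_mem' := by
    intro c x hx y hy
    rw [smul_dotProduct, hx y hy, smul_zero]

/-! ### The binary erasure channel and erasure thresholds -/

/-- Transition probabilities of the binary erasure channel with erasure rate `δ`;
the output `none` is the erasure symbol. -/
def becProb (δ : ℝ) (b : ZMod 2) : Option (ZMod 2) → ℝ
  | none => δ
  | some b' => if b' = b then 1 - δ else 0

/-- A decoder for words of length `n` received over an erasure channel. -/
abbrev BECDecoder (n : ℕ) : Type := (Fin n → Option (ZMod 2)) → BinWord n

/-- Which error probability is considered: that of words or that of bits. -/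
inductive ErrorCriterion
  | word
  | bit

/-- The loss whose mean is the word (bit) error probability: the indicator of a wrong word
(the fraction of wrong bits). -/
def ErrorCriterion.loss {n : ℕ} : ErrorCriterion → BinWord n → BinWord n → ℝ
  | .word, c, c' => if c' = c then 0 else 1
  | .bit, c, c' => (hammingDist c' c : ℝ) / n

open Classical in
/-- The word (bit) error probability of the decoder `D` when a uniformly distributed codeword
of `C` is sent over `n` uses of the memoryless erasure channel with erasure rate `δ`. -/
def becErrorProb {n : ℕ} (crit : ErrorCriterion) (C : BinCode n) (D : BECDecoder n) (δ : ℝ) : ℝ :=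
  (∑ c : C, ∑ y : Fin n → Option (ZMod 2),
    (∏ i, becProb δ ((c : BinWord n) i) (y i)) * crit.loss (c : BinWord n) (D y)) /
      (Fintype.card C : ℝ)

/-- `δs` is the erasure rate threshold of the code sequence `C` (`C j` has length `N j`) for the
decoders `D δ j` (which may be matched to the erasure rate `δ`): it is the worst erasure rate,
i.e. the supremum of the erasure rates in `[0,1]`, at which the word (bit) error probability tends
to zero. -/
def IsErasureThreshold {N : ℕ → ℕ} (crit : ErrorCriterion) (C : ∀ j, BinCode (N j))
    (D : ℝ → ∀ j, BECDecoder (N j)) (δs : ℝ) : Prop :=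
  IsLUB {δ : ℝ | δ ∈ Set.Icc (0 : ℝ) 1 ∧
    Tendsto (fun j => becErrorProb crit (C j) (D δ j) δ) atTop (𝓝 0)} δs

/-! ### The binary-input Gaussian channel -/

/-- The Gaussian tail function `Q`. -/
def gaussQ (x : ℝ) : ℝ :=
  ∫ z in Set.Ioi x, 1 / √(2 * Real.pi) * Real.exp (-z ^ 2 / 2)

/-- The channel symbol of a bit: `0 ↦ 1`, `1 ↦ -1`. -/
def bpsk (b : ZMod 2) : ℝ := if b = 0 then 1 else -1

/-- Transition density `g(z | X = x)` of the binary-input Gaussian channel with SNR `lam`: the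
density of the normal law with mean `-x √(2 lam)` and variance `1`, where `x = bpsk b`. -/
def biawgnPDF (lam : ℝ) (b : ZMod 2) (z : ℝ) : ℝ :=
  ProbabilityTheory.gaussianPDFReal (-bpsk b * √(2 * lam)) 1 z

/-! ### Codes for the type II wiretap channel -/

/-- A code of length `n` for a binary-input wiretap channel with noiseless main channel: a finite
set of messages, a stochastic encoder and a decoder for the legitimate receiver. -/
structure WiretapCode (n : ℕ) where
  Msg : Type
  [fintypeMsg : Fintype Msg]
  enc : Msg → PMF (BinWord n)
  dec : BinWord n → Msg

attribute [instance] WiretapCode.fintypeMsg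

/-- The information rate `log₂ M / n`. -/
def WiretapCode.rate {n : ℕ} (K : WiretapCode n) : ℝ :=
  Real.logb 2 (Fintype.card K.Msg : ℝ) / n

open Classical in
/-- The average error probability of the legitimate receiver, who observes the transmitted word,
for a uniformly distributed message. -/
def WiretapCode.errorProb {n : ℕ} (K : WiretapCode n) : ℝ :=
  (∑ w : K.Msg, ∑ x : BinWord n, (K.enc w x).toReal * (if K.dec x = w then 0 else 1)) /
    (Fintype.card K.Msg : ℝ)

/-- The density on `ℝⁿ` of the eavesdropper's observation `Z`, given the message `w`, when the
eavesdropper's channel is the memoryless binary-input Gaussian channel with SNR `lam`. -/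
def WiretapCode.eavesPDF {n : ℕ} (K : WiretapCode n) (lam : ℝ) (w : K.Msg) (z : Fin n → ℝ) : ℝ :=
  ∑ x : BinWord n, (K.enc w x).toReal * ∏ i, biawgnPDF lam (x i) (z i)

/-- The conditional entropy `H(A | Z)`, in bits, of a random variable `A` with finitely many
values and probabilities `p a`, given a random vector `Z` in `ℝⁿ` with conditional densities
`f a` given `A = a`: the mean over `Z` of the entropy of the posterior law of `A`. -/
def condEntropyBits {α : Type*} [Fintype α] {n : ℕ} (p : α → ℝ) (f : α → (Fin n → ℝ) → ℝ) : ℝ :=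
  ∫ z : Fin n → ℝ, (∑ a, p a * f a z) *
    ((∑ a, Real.negMulLog (p a * f a z / ∑ b, p b * f b z)) / Real.log 2)

/-- The equivocation `H(W | Z)` of the eavesdropper, in bits, for a uniformly distributed
message `W`. -/
def WiretapCode.equivocation {n : ℕ} (K : WiretapCode n) (lam : ℝ) : ℝ :=
  condEntropyBits (fun _ : K.Msg => 1 / (Fintype.card K.Msg : ℝ)) (K.eavesPDF lam)

/-- The code sequence `K` (`K j` has length `N j`) achieves the rate-equivocation pair `(R, Re)`
over the type II Gaussian wiretap channel with SNR `lam`: its lengths tend to infinity, it has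
rate `R`, the error probability of the legitimate receiver tends to zero, and
`Re ≤ lim H(W | Z) / n`, where the limit exists. -/
def AchievesPair {N : ℕ → ℕ} (K : ∀ j, WiretapCode (N j)) (lam R Re : ℝ) : Prop :=
  Tendsto N atTop atTop ∧
  Tendsto (fun j => (K j).rate) atTop (𝓝 R) ∧
  Tendsto (fun j => (K j).errorProb) atTop (𝓝 0) ∧
  ∃ L : ℝ, Tendsto (fun j => (K j).equivocation lam / N j) atTop (𝓝 L) ∧ Re ≤ L

/-! ### Secure nested codes -/

open Classical in
/-- The words of the coset `w` of `C₁` in `C₀`. -/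
def cosetWords {n : ℕ} (C₀ C₁ : BinCode n) (w : C₀ ⧸ C₁.submoduleOf C₀) : Finset (BinWord n) :=
  Finset.univ.filter fun x => ∃ h : x ∈ C₀, (C₁.submoduleOf C₀).mkQ ⟨x, h⟩ = w

open Classical in
theorem cosetWords_nonempty {n : ℕ} (C₀ C₁ : BinCode n) (w : C₀ ⧸ C₁.submoduleOf C₀) :
    (cosetWords C₀ C₁ w).Nonempty := by
  obtain ⟨x, hx⟩ := (C₁.submoduleOf C₀).mkQ_surjective w
  exact ⟨x, Finset.mem_filter.mpr ⟨Finset.mem_univ _, x.2, hx⟩⟩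

open Classical in
/-- The secure nested code of a fine code `C₀` and a coarse code `C₁ ⊆ C₀`: the messages are the
cosets of `C₁` in `C₀`, a message is encoded as a uniformly distributed word of its coset, and the
legitimate receiver determines the coset of the received word. -/
def secureNestedCode {n : ℕ} (C₀ C₁ : BinCode n) (_h : C₁ ≤ C₀) : WiretapCode n where
  Msg := C₀ ⧸ C₁.submoduleOf C₀
  fintypeMsg := Fintype.ofFinite _
  enc w := PMF.uniformOfFinset (cosetWords C₀ C₁ w) (cosetWords_nonempty C₀ C₁ w)
  dec y := if h : y ∈ C₀ then (C₁.submoduleOf C₀).mkQ ⟨y, h⟩ else 0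

end Wiretap

end

/-!
The Gaussian channel of the eavesdropper is a degraded erasure channel. The densities of its output
for the two input symbols have a common part of mass `ε = 2 Q(√(2 lam))`; drawing the output from
the common part (an erasure) or from the excess of the density of the symbol sent over it (no
erasure) gives the right law. Telling the eavesdropper which positions are erased, and the bits at
the others, only decreases the equivocation; this is concavity of the entropy
(`sum_mul_massEntropy_le`).

The message is the coset of the dual code `C^⊥` that contains the word sent, so it has
`k = dim C` bits. If the eavesdropper knows the bits of this word on a set `I` of positions and
nothing else, then `k - d(I)` bits of the message are uniformly distributed to her, where `d(I)` is
the dimension of the space of codewords of `C` supported on `I` (`cosetMass_dualCode_le`). As every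
position lies in `I` with probability `1 - ε` independently, the equivocation is at least
`k - F(1 - ε)`, where `F(p)` is the mean of `d(I)` for a random set `I` that includes every position
with probability `p` (`meanAmbiguity`, `le_equivocation`). It is at most `k`, the number of bits of
the message (`equivocation_le`).

When `C` is used on an erasure channel of erasure rate `δ` and `I` is the set of erased positions,
`d(I)` is the number of bits of the codeword that remain unknown. Any decoder has to guess at least
`d(I)` positions, so `F(δ) / n` is at most twice the bit error probability, hence at most twice the
word error probability (`meanAmbiguity_div_le_becErrorProb`). Thus `F(δ) / n → 0` at erasure
rates `δ` arbitrarily close to the threshold `δ*`. As `F` is monotone and `n`-Lipschitz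
(`meanAmbiguity_le`), `F(p) / n → 0` for all `p ≤ δ*`, and in particular for `p = 1 - ε`.
-/

namespace Wiretap

/-! ### Random sets of positions -/

/-- Push-forward of product weights: if independent labels `t i` of weight `w i` are mapped
coordinatewise by `π i`, the images are independent with the push-forward weights. -/
theorem sum_prod_mul_comp {ι α β : Type*} [Fintype ι] [DecidableEq ι] [Fintype α] [Fintype β]
    [DecidableEq β] (w : ι → α → ℝ) (π : ι → α → β) (g : (ι → β) → ℝ) :
    ∑ t : ι → α, (∏ i, w i (t i)) * g (fun i => π i (t i)) =
      ∑ s : ι → β, (∏ i, ∑ a with π i a = s i, w i a) * g s := by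
  rw [← Finset.sum_fiberwise Finset.univ (fun (t : ι → α) i => π i (t i))]
  refine Finset.sum_congr rfl fun s _ => ?_
  rw [Finset.prod_univ_sum, Finset.sum_mul]
  refine Finset.sum_congr ?_ ?_
  · ext t
    simp [funext_iff]
  · intro t ht
    rw [show (fun i => π i (t i)) = s from funext fun i => by simpa using Fintype.mem_piFinset.mp ht i]

/-- The marginal of a product of probability weights at one coordinate. -/
theorem sum_prod_mul_single {ι α : Type*} [Fintype ι] [DecidableEq ι] [Fintype α]
    (w : α → ℝ) (hw : ∑ a, w a = 1) (φ : α → ℝ) (i : ι) :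
    ∑ t : ι → α, (∏ j, w (t j)) * φ (t i) = ∑ a, w a * φ a := by
  have h (t : ι → α) : (∏ j, w (t j)) * φ (t i) =
      ∏ j, w (t j) * (if j = i then φ (t j) else 1) := by
    rw [Finset.prod_mul_distrib]
    simp
  simp_rw [h]
  rw [← Fintype.prod_sum (fun j a => w a * (if j = i then φ a else 1)),
    Fintype.prod_eq_single i (fun j hj => by simp [hj, hw])]
  simp

/-- The weight of a coordinate label under the Bernoulli law: `true` has probability `p`. -/
def bernWeight (p : ℝ) (b : Bool) : ℝ := if b then p else 1 - p

theorem bernWeight_nonneg {p : ℝ} (h0 : 0 ≤ p) (h1 : p ≤ 1) (b : Bool) : 0 ≤ bernWeight p b := by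
  cases b <;> simp [bernWeight, h0, h1]

theorem sum_prod_bernWeight (n : ℕ) (p : ℝ) :
    ∑ s : Fin n → Bool, ∏ i, bernWeight p (s i) = 1 := by
  rw [← Fintype.prod_sum (fun (_ : Fin n) b => bernWeight p b)]
  simp [bernWeight]

/-- The subcode of the words of `C` that vanish at every position marked `false`. -/
def shortened {n : ℕ} (C : BinCode n) (s : Fin n → Bool) : BinCode n where
  carrier := {x | x ∈ C ∧ ∀ i, s i = false → x i = 0}
  add_mem' := by
    rintro a b ⟨ha, ha'⟩ ⟨hb, hb'⟩
    exact ⟨C.add_mem ha hb, fun i hi => by simp [ha' i hi, hb' i hi]⟩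
  zero_mem' := ⟨C.zero_mem, fun _ _ => rfl⟩
  smul_mem' := by
    rintro c x ⟨hx, hx'⟩
    exact ⟨C.smul_mem c hx, fun i hi => by simp [hx' i hi]⟩

theorem mem_shortened {n : ℕ} {C : BinCode n} {s : Fin n → Bool} {x : BinWord n} :
    x ∈ shortened C s ↔ x ∈ C ∧ ∀ i, s i = false → x i = 0 := Iff.rfl

/-- If the words of `A` that vanish on `T` lie in `B`, then `dim A ≤ dim B + |T|`: restrict the words
of `A` to `T` and use rank-nullity. -/
theorem finrank_le_finrank_add_card {n : ℕ} (A B : BinCode n) (T : Finset (Fin n))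
    (h : ∀ x ∈ A, (∀ i ∈ T, x i = 0) → x ∈ B) :
    Module.finrank (ZMod 2) A ≤ Module.finrank (ZMod 2) B + T.card := by
  let f : A →ₗ[ZMod 2] (T → ZMod 2) := (LinearMap.funLeft (ZMod 2) (ZMod 2) Subtype.val) ∘ₗ A.subtype
  have h1 := f.finrank_range_add_finrank_ker
  have h2 : Module.finrank (ZMod 2) (LinearMap.range f) ≤ T.card := by
    simpa using Submodule.finrank_le (LinearMap.range f)
  have h3 : Module.finrank (ZMod 2) (LinearMap.ker f) ≤ Module.finrank (ZMod 2) B := by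
    have hle : (LinearMap.ker f).map A.subtype ≤ B := by
      rintro _ ⟨x, hx, rfl⟩
      refine h _ x.2 fun i hi => ?_
      exact congrFun (LinearMap.mem_ker.mp hx) ⟨i, hi⟩
    calc _ = Module.finrank (ZMod 2) ((LinearMap.ker f).map A.subtype) :=
          (Submodule.finrank_map_subtype_eq A _).symm
      _ ≤ _ := Submodule.finrank_mono hle
  omega

theorem finrank_shortened_le {n : ℕ} (C : BinCode n) (s s' : Fin n → Bool) :
    Module.finrank (ZMod 2) (shortened C s) ≤ Module.finrank (ZMod 2) (shortened C s') +
      (Finset.univ.filter fun i => s i = true ∧ s' i = false).card := by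
  refine finrank_le_finrank_add_card _ _ _ fun x hx h => ⟨hx.1, fun i hi => ?_⟩
  cases hsi : s i
  · exact hx.2 i hsi
  · exact h i (by simp [hi, hsi])

theorem finrank_shortened_le_card_support {n : ℕ} (C : BinCode n) (s : Fin n → Bool)
    (T : Finset (Fin n)) (hT : ∀ i ∉ T, ∀ u ∈ shortened C s, u i = 0) :
    Module.finrank (ZMod 2) (shortened C s) ≤ T.card := by
  have := finrank_le_finrank_add_card (shortened C s) ⊥ T fun x hx h => by
    rw [Submodule.mem_bot]
    ext i
    by_cases hi : i ∈ T
    · exact h i hi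
    · exact hT i hi x hx
  simpa using this

theorem finrank_dualCode {n : ℕ} (C : BinCode n) :
    Module.finrank (ZMod 2) C + Module.finrank (ZMod 2) (dualCode C) = n := by
  have h : (dualCode C).map (dotProductEquiv (ZMod 2) (Fin n)).toLinearMap =
      C.dualAnnihilator := by
    ext φ
    constructor
    · rintro ⟨x, hx, rfl⟩
      rw [Submodule.mem_dualAnnihilator]
      intro y hy
      exact hx y hy
    · intro hφ
      refine ⟨(dotProductEquiv (ZMod 2) (Fin n)).symm φ, fun y hy => ?_, by simp⟩
      have := (Submodule.mem_dualAnnihilator φ).mp hφ y hy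
      rw [← LinearEquiv.apply_symm_apply (dotProductEquiv (ZMod 2) (Fin n)) φ] at this
      exact this
  have h2 : Module.finrank (ZMod 2) (dualCode C) = Module.finrank (ZMod 2) C.dualAnnihilator := by
    rw [← h]
    exact ((dotProductEquiv (ZMod 2) (Fin n)).finrank_map_eq (dualCode C)).symm
  have h3 := Subspace.finrank_add_finrank_dualAnnihilator_eq C
  rw [Module.finrank_fin_fun] at h3
  rw [h2, h3]

/-- The words of the dual code that vanish on the positions marked `true` are orthogonal both to `C`
and to all words supported on these positions; this bounds their number from above. (Equality
holds, but only this inequality enters the lower bound for the equivocation.) -/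
theorem finrank_shortened_dualCode_le {n : ℕ} (C : BinCode n) (s : Fin n → Bool) :
    Module.finrank (ZMod 2) (shortened (dualCode C) (fun i => !s i)) +
      Module.finrank (ZMod 2) C + (Finset.univ.filter fun i => s i = true).card ≤
      n + Module.finrank (ZMod 2) (shortened C s) := by
  have hle : shortened (dualCode C) (fun i => !s i) ≤ dualCode (C ⊔ shortened ⊤ s) := by
    rintro x ⟨hx, hx'⟩ y hy
    obtain ⟨a, ha, b, hb, rfl⟩ := Submodule.mem_sup.mp hy
    rw [dotProduct_add, hx a ha, zero_add]
    refine Finset.sum_eq_zero fun i _ => ?_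
    cases hsi : s i
    · rw [hb.2 i hsi, mul_zero]
    · rw [hx' i (by simp [hsi]), zero_mul]
  have h1 := Submodule.finrank_mono hle
  have h2 := finrank_dualCode (C ⊔ shortened ⊤ s)
  have h3 := Submodule.finrank_sup_add_finrank_inf_eq C (shortened ⊤ s)
  have h4 : C ⊓ shortened ⊤ s = shortened C s := by
    ext x
    simp [mem_shortened]
  have h5 := finrank_shortened_le (⊤ : BinCode n) (fun _ => true) s
  have h6 : shortened (⊤ : BinCode n) (fun _ => true) = ⊤ := by
    ext x
    simp [mem_shortened]
  rw [h4] at h3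
  rw [h6, finrank_top, Module.finrank_fin_fun] at h5
  have h7 := Finset.card_filter_add_card_filter_not (s := (Finset.univ : Finset (Fin n)))
    (fun i => s i = true)
  simp only [true_and, Finset.card_univ, Fintype.card_fin, Bool.not_eq_true] at h5 h7
  omega

/-- The mean dimension of the space of codewords supported on a random set of positions, where
every position is included with probability `p` independently: the expected number of bits
of a codeword that remain unknown after an erasure channel with erasure rate `p`. -/
noncomputable def meanAmbiguity {n : ℕ} (C : BinCode n) (p : ℝ) : ℝ :=
  ∑ s : Fin n → Bool, (∏ i, bernWeight p (s i)) * (Module.finrank (ZMod 2) (shortened C s) : ℝ)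

theorem meanAmbiguity_nonneg {n : ℕ} (C : BinCode n) {p : ℝ} (h0 : 0 ≤ p) (h1 : p ≤ 1) :
    0 ≤ meanAmbiguity C p :=
  Finset.sum_nonneg fun _ _ => mul_nonneg
    (Finset.prod_nonneg fun _ _ => bernWeight_nonneg h0 h1 _) (Nat.cast_nonneg _)

/-- The mean ambiguity is nondecreasing and Lipschitz in the erasure rate, with constant `n`. The
Lipschitz bound is what makes the erasure threshold itself admissible, where the error probability
need not tend to zero. -/
theorem meanAmbiguity_le {n : ℕ} (C : BinCode n) {p q : ℝ} (hp0 : 0 ≤ p) (hp1 : p ≤ 1)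
    (hq0 : 0 ≤ q) (hq1 : q ≤ 1) :
    meanAmbiguity C p ≤ meanAmbiguity C q + n * max (p - q) 0 := by
  -- The monotone coupling of the Bernoulli laws with parameters `p` and `q`.
  let w : Bool × Bool → ℝ := fun b =>
    match b with
    | (true, true) => min p q
    | (true, false) => p - min p q
    | (false, true) => q - min p q
    | (false, false) => 1 - max p q
  have hw0 : ∀ b, 0 ≤ w b := by
    rintro ⟨_ | _, _ | _⟩ <;> simp [w, *]
  have hmm := min_add_max p q
  have hfst (b : Bool) : ∑ a : Bool × Bool with a.1 = b, w a = bernWeight p b := by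
    rw [Finset.sum_filter, Fintype.sum_prod_type]
    cases b <;> simp [w, bernWeight]; linarith
  have hsnd (b : Bool) : ∑ a : Bool × Bool with a.2 = b, w a = bernWeight q b := by
    rw [Finset.sum_filter, Fintype.sum_prod_type]
    cases b <;> simp [w, bernWeight]; linarith
  have hw1 : ∑ a, w a = 1 := by
    rw [Fintype.sum_prod_type]
    simp [w]; linarith
  have h1 := sum_prod_mul_comp (fun (_ : Fin n) => w) (fun _ => Prod.fst)
    (fun s => (Module.finrank (ZMod 2) (shortened C s) : ℝ))
  have h2 := sum_prod_mul_comp (fun (_ : Fin n) => w) (fun _ => Prod.snd)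
    (fun s => (Module.finrank (ZMod 2) (shortened C s) : ℝ))
  simp only [hfst, hsnd] at h1 h2
  let φ : Bool × Bool → ℝ := fun a => if a.1 = true ∧ a.2 = false then 1 else 0
  have h3 : ∑ t : Fin n → Bool × Bool, (∏ i, w (t i)) * ∑ i, φ (t i) = n * max (p - q) 0 := by
    simp_rw [Finset.mul_sum]
    rw [Finset.sum_comm]
    simp_rw [sum_prod_mul_single w hw1 φ]
    have : ∑ a, w a * φ a = max (p - q) 0 := by
      rw [Fintype.sum_prod_type]
      simp only [φ, w, Fintype.sum_bool]
      rcases le_total p q with h | h <;> simp [h]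
    simp [this]
  rw [meanAmbiguity, meanAmbiguity, ← h1, ← h2, ← h3, ← Finset.sum_add_distrib]
  refine Finset.sum_le_sum fun t _ => ?_
  rw [← mul_add]
  refine mul_le_mul_of_nonneg_left ?_ (Finset.prod_nonneg fun i _ => hw0 _)
  have := finrank_shortened_le C (fun i => (t i).1) (fun i => (t i).2)
  have hc : ∑ i, φ (t i) =
      ((Finset.univ.filter fun i => (t i).1 = true ∧ (t i).2 = false).card : ℝ) := by
    simp [φ]
  rw [hc]
  exact_mod_cast this

/-! ### Error probability on the erasure channel -/

/-- The output of the erasure channel on input `c` when the positions marked `true` are erased. -/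
def erase {n : ℕ} (s : Fin n → Bool) (c : BinWord n) : Fin n → Option (ZMod 2) :=
  fun i => if s i then none else some (c i)

theorem erase_add {n : ℕ} (C : BinCode n) (s : Fin n → Bool) (c u : BinWord n)
    (hu : u ∈ shortened C s) : erase s (c + u) = erase s c := by
  ext1 i
  cases hs : s i
  · simp [erase, hs, hu.2 i hs]
  · simp [erase, hs]

theorem sum_prod_becProb_mul {n : ℕ} (δ : ℝ) (c : BinWord n)
    (g : (Fin n → Option (ZMod 2)) → ℝ) :
    ∑ y : Fin n → Option (ZMod 2), (∏ i, becProb δ (c i) (y i)) * g y =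
      ∑ s : Fin n → Bool, (∏ i, bernWeight δ (s i)) * g (erase s c) := by
  have h := sum_prod_mul_comp (fun (_ : Fin n) => bernWeight δ)
    (fun i b => if b then none else some (c i)) g
  unfold erase
  rw [h]
  refine Finset.sum_congr rfl fun y _ => ?_
  congr 1
  refine Finset.prod_congr rfl fun i _ => ?_
  rw [Finset.sum_filter, Fintype.sum_bool]
  rcases y i with _ | b
  · simp [becProb, bernWeight]
  · simp [becProb, bernWeight, eq_comm]

theorem becProb_nonneg {δ : ℝ} (h0 : 0 ≤ δ) (h1 : δ ≤ 1) (b : ZMod 2) (o : Option (ZMod 2)) :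
    0 ≤ becProb δ b o := by
  rcases o with _ | b'
  · exact h0
  · simp only [becProb]
    split_ifs <;> linarith

theorem bit_loss_le {n : ℕ} (crit : ErrorCriterion) (c c' : BinWord n) :
    (hammingDist c' c : ℝ) / n ≤ crit.loss c c' := by
  cases crit
  · simp only [ErrorCriterion.loss]
    split_ifs with h
    · simp [h]
    · have : (hammingDist c' c : ℝ) ≤ n := by
        exact_mod_cast (hammingDist_le_card_fintype (x := c') (y := c)).trans_eq (by simp)
      exact div_le_one_of_le₀ this (Nat.cast_nonneg _)
  · exact le_rfl

/-- If some codeword `u` supported on the erased positions has a nonzero bit `i`, a decoder is wrong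
about bit `i` for at least half of the codewords: `c` and `c + u` give the same channel output. -/
theorem card_le_two_mul_sum_wrong_bit {n : ℕ} (C : BinCode n) [Fintype C] (s : Fin n → Bool)
    (D : BECDecoder n) (i : Fin n) (u : BinWord n) (hu : u ∈ shortened C s) (hi : u i ≠ 0) :
    (Fintype.card C : ℝ) ≤
      2 * ∑ c : C, if D (erase s c) i ≠ (c : BinWord n) i then (1 : ℝ) else 0 := by
  have h := Equiv.sum_comp (Equiv.addRight (⟨u, hu.1⟩ : C))
    (fun c : C => if D (erase s c) i ≠ (c : BinWord n) i then (1 : ℝ) else 0)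
  rw [two_mul]
  nth_rewrite 1 [← h]
  rw [← Finset.sum_add_distrib, ← Finset.card_univ, Finset.cast_card]
  refine Finset.sum_le_sum fun c _ => ?_
  simp only [Equiv.coe_addRight, Submodule.coe_add, erase_add C s _ u hu, Pi.add_apply]
  by_cases hc : D (erase s c) i = (c : BinWord n) i
  · simp [hc, hi]
  · simp only [ne_eq, hc, not_false_eq_true, if_true]
    split_ifs <;> norm_num

/-- For a fixed erasure pattern, the mean number of wrong bits of any decoder is at least half of the
dimension of the space of codewords supported on the erased positions. -/
theorem card_mul_finrank_shortened_le {n : ℕ} (C : BinCode n) [Fintype C] (s : Fin n → Bool)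
    (D : BECDecoder n) :
    (Fintype.card C : ℝ) * Module.finrank (ZMod 2) (shortened C s) ≤
      2 * ∑ c : C, (hammingDist (D (erase s c)) (c : BinWord n) : ℝ) := by
  classical
  let T : Finset (Fin n) := Finset.univ.filter fun i => ∃ u ∈ shortened C s, u i ≠ 0
  have hT : Module.finrank (ZMod 2) (shortened C s) ≤ T.card :=
    finrank_shortened_le_card_support C s T fun i hi u hu => by
      by_contra hne
      exact hi (Finset.mem_filter.mpr ⟨Finset.mem_univ _, u, hu, hne⟩)
  have hdist (c : C) : (hammingDist (D (erase s c)) (c : BinWord n) : ℝ) =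
      ∑ i, if D (erase s c) i ≠ (c : BinWord n) i then (1 : ℝ) else 0 := by
    rw [hammingDist, Finset.natCast_card_filter]
  simp_rw [hdist]
  rw [Finset.sum_comm, Finset.mul_sum]
  calc (Fintype.card C : ℝ) * Module.finrank (ZMod 2) (shortened C s)
      ≤ (Fintype.card C : ℝ) * T.card := by gcongr
    _ = ∑ _i ∈ T, (Fintype.card C : ℝ) := by simp [mul_comm]
    _ ≤ ∑ i ∈ T, 2 * ∑ c : C, (if D (erase s c) i ≠ (c : BinWord n) i then (1 : ℝ) else 0) := by
        refine Finset.sum_le_sum fun i hi => ?_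
        obtain ⟨u, hu, hne⟩ := (Finset.mem_filter.mp hi).2
        exact card_le_two_mul_sum_wrong_bit C s D i u hu hne
    _ ≤ _ := by
        refine Finset.sum_le_sum_of_subset_of_nonneg (Finset.subset_univ _) fun i _ _ => ?_
        refine mul_nonneg zero_le_two (Finset.sum_nonneg fun c _ => ?_)
        split_ifs <;> norm_num

/-- Whatever the decoder, a small word or bit error probability forces a small mean ambiguity per
bit. -/
theorem meanAmbiguity_div_le_becErrorProb {n : ℕ} (crit : ErrorCriterion) (C : BinCode n)
    (D : BECDecoder n) {δ : ℝ} (h0 : 0 ≤ δ) (h1 : δ ≤ 1) :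
    meanAmbiguity C δ / n ≤ 2 * becErrorProb crit C D δ := by
  classical
  have hcard : (0 : ℝ) < Fintype.card C := by exact_mod_cast Fintype.card_pos
  have hbit : (∑ c : C, ∑ y : Fin n → Option (ZMod 2),
      (∏ i, becProb δ ((c : BinWord n) i) (y i)) * ((hammingDist (D y) (c : BinWord n) : ℝ) / n)) /
        (Fintype.card C : ℝ) ≤ becErrorProb crit C D δ := by
    unfold becErrorProb
    gcongr with c _ y _
    · exact Finset.prod_nonneg fun i _ => becProb_nonneg h0 h1 _ _
    · exact bit_loss_le crit _ _
  refine le_trans ?_ (mul_le_mul_of_nonneg_left hbit zero_le_two)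
  simp_rw [sum_prod_becProb_mul]
  rw [Finset.sum_comm, mul_div_assoc', le_div_iff₀ hcard, meanAmbiguity, Finset.sum_div,
    Finset.sum_mul, Finset.mul_sum]
  refine Finset.sum_le_sum fun s _ => ?_
  rw [← Finset.mul_sum, ← Finset.sum_div]
  have hs := card_mul_finrank_shortened_le C s D
  have hp : 0 ≤ ∏ i, bernWeight δ (s i) := Finset.prod_nonneg fun i _ => bernWeight_nonneg h0 h1 _
  calc _ = (∏ i, bernWeight δ (s i)) *
        (((Fintype.card C : ℝ) * Module.finrank (ZMod 2) (shortened C s)) / n) := by ring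
    _ ≤ (∏ i, bernWeight δ (s i)) *
        ((2 * ∑ c : C, (hammingDist (D (erase s c)) (c : BinWord n) : ℝ)) / n) := by gcongr
    _ = _ := by ring

/-! ### Unnormalized entropy -/

/-- The unnormalized entropy, in nats, of a finite family of nonnegative numbers: its sum times
the entropy of the probability vector proportional to it. -/
noncomputable def massEntropy {α : Type*} [Fintype α] (q : α → ℝ) : ℝ :=
  (∑ a, q a) * ∑ a, Real.negMulLog (q a / ∑ b, q b)

theorem massEntropy_nonneg {α : Type*} [Fintype α] (q : α → ℝ) (hq : ∀ a, 0 ≤ q a) :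
    0 ≤ massEntropy q := by
  have hT : 0 ≤ ∑ a, q a := Finset.sum_nonneg fun a _ => hq a
  refine mul_nonneg hT (Finset.sum_nonneg fun a _ => Real.negMulLog_nonneg (div_nonneg (hq a) hT) ?_)
  exact div_le_one_of_le₀ (Finset.single_le_sum (fun a _ => hq a) (Finset.mem_univ a)) hT

theorem massEntropy_le {α : Type*} [Fintype α] (q : α → ℝ) (hq : ∀ a, 0 ≤ q a) :
    massEntropy q ≤ (∑ a, q a) * Real.log (Fintype.card α) := by
  have hT : 0 ≤ ∑ a, q a := Finset.sum_nonneg fun a _ => hq a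
  rcases hT.eq_or_lt with h0 | hpos
  · simp [massEntropy, ← h0]
  refine mul_le_mul_of_nonneg_left ?_ hT
  have hM : 0 < (Fintype.card α : ℝ) := by
    rcases isEmpty_or_nonempty α with h | h
    · simp at hpos
    · exact_mod_cast Fintype.card_pos
  -- `log t ≤ t - 1` at `t = 1 / (M x)`, where `M` is the number of indices.
  have key (x : ℝ) (hx : 0 ≤ x) : Real.negMulLog x ≤
      x * Real.log (Fintype.card α) + (1 / Fintype.card α - x) := by
    rcases hx.eq_or_lt with rfl | hx
    · simp
    have h := Real.log_le_sub_one_of_pos (x := 1 / (Fintype.card α * x)) (by positivity)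
    rw [Real.log_div one_ne_zero (by positivity), Real.log_one,
      Real.log_mul hM.ne' hx.ne'] at h
    have h2 := mul_le_mul_of_nonneg_left h hx.le
    have h3 : x * (1 / (Fintype.card α * x) - 1) = 1 / Fintype.card α - x := by
      field_simp
    rw [h3] at h2
    rw [Real.negMulLog]
    linarith
  calc ∑ a, Real.negMulLog (q a / ∑ b, q b)
      ≤ ∑ a, ((q a / ∑ b, q b) * Real.log (Fintype.card α) +
          (1 / Fintype.card α - q a / ∑ b, q b)) :=
        Finset.sum_le_sum fun a _ => key _ (div_nonneg (hq a) hT)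
    _ = Real.log (Fintype.card α) := by
        rw [Finset.sum_add_distrib, Finset.sum_sub_distrib, ← Finset.sum_mul, ← Finset.sum_div,
          div_self hpos.ne']
        simp [hM.ne']

/-- The entropy is at least the min-entropy. -/
theorem mul_le_massEntropy {α : Type*} [Fintype α] (q : α → ℝ) (hq : ∀ a, 0 ≤ q a) (L : ℝ)
    (hL : ∀ a, q a ≤ (∑ b, q b) * Real.exp (-L)) :
    (∑ a, q a) * L ≤ massEntropy q := by
  have hT : 0 ≤ ∑ a, q a := Finset.sum_nonneg fun a _ => hq a
  rcases hT.eq_or_lt with h0 | hpos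
  · simp [massEntropy, ← h0]
  refine mul_le_mul_of_nonneg_left ?_ hT
  calc L = ∑ a, (q a / ∑ b, q b) * L := by
        rw [← Finset.sum_mul, ← Finset.sum_div, div_self hpos.ne', one_mul]
    _ ≤ _ := by
        refine Finset.sum_le_sum fun a _ => ?_
        rcases (hq a).eq_or_lt with h | h
        · simp [← h]
        have hx : 0 < q a / ∑ b, q b := div_pos h hpos
        have h2 : Real.log (q a / ∑ b, q b) ≤ -L := by
          rw [Real.log_le_iff_le_exp hx, div_le_iff₀ hpos, mul_comm]
          exact hL a
        rw [Real.negMulLog, neg_mul, ← mul_neg]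
        exact mul_le_mul_of_nonneg_left (by linarith) hx.le

/-- Entropy decreases under conditioning: the unnormalized entropy of a mixture is at least the
mixture of the unnormalized entropies. -/
theorem sum_mul_massEntropy_le {α κ : Type*} [Fintype α] [Fintype κ] (c : κ → ℝ)
    (hc : ∀ k, 0 ≤ c k) (q : κ → α → ℝ) (hq : ∀ k a, 0 ≤ q k a) :
    ∑ k, c k * massEntropy (q k) ≤ massEntropy fun a => ∑ k, c k * q k a := by
  have hTk (k : κ) : 0 ≤ ∑ a, q k a := Finset.sum_nonneg fun a _ => hq k a
  have hsum : ∑ a, ∑ k, c k * q k a = ∑ k, c k * ∑ a, q k a := by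
    rw [Finset.sum_comm]
    simp_rw [Finset.mul_sum]
  have hT : 0 ≤ ∑ k, c k * ∑ a, q k a := Finset.sum_nonneg fun k _ => mul_nonneg (hc k) (hTk k)
  unfold massEntropy
  rw [hsum]
  rcases hT.eq_or_lt with h0 | hpos
  · rw [← h0, zero_mul]
    have h0' := (Finset.sum_eq_zero_iff_of_nonneg fun k _ => mul_nonneg (hc k) (hTk k)).mp h0.symm
    refine (Finset.sum_eq_zero fun k hk => ?_).le
    rw [← mul_assoc, h0' k hk, zero_mul]
  have hrw : ∑ k, c k * ((∑ a, q k a) * ∑ a, Real.negMulLog (q k a / ∑ b, q k b)) =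
      (∑ k, c k * ∑ a, q k a) * ∑ a, ∑ k, (c k * (∑ b, q k b) / ∑ k, c k * ∑ a, q k a) •
        Real.negMulLog (q k a / ∑ b, q k b) := by
    rw [Finset.sum_comm, Finset.mul_sum]
    refine Finset.sum_congr rfl fun k _ => ?_
    simp only [smul_eq_mul]
    rw [← Finset.mul_sum, ← mul_assoc, ← mul_assoc, mul_div_cancel₀ _ hpos.ne']
  rw [hrw]
  refine mul_le_mul_of_nonneg_left (Finset.sum_le_sum fun a _ => ?_) hT
  have hJ := Real.concaveOn_negMulLog.le_map_sum (t := Finset.univ)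
    (w := fun k => c k * (∑ b, q k b) / ∑ k, c k * ∑ a, q k a)
    (p := fun k => q k a / ∑ b, q k b)
    (fun k _ => div_nonneg (mul_nonneg (hc k) (hTk k)) hT)
    (by rw [← Finset.sum_div, div_self hpos.ne'])
    (fun k _ => div_nonneg (hq k a) (hTk k))
  refine hJ.trans_eq ?_
  congr 1
  rw [Finset.sum_div]
  refine Finset.sum_congr rfl fun k _ => ?_
  rw [smul_eq_mul]
  rcases (hTk k).eq_or_lt with h | h
  · have : q k a = 0 :=
      (Finset.sum_eq_zero_iff_of_nonneg fun a _ => hq k a).mp h.symm a (Finset.mem_univ a)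
    simp [this]
  · field_simp

/-! ### The Gaussian channel as a degraded erasure channel -/

open MeasureTheory

/-- The common part `min (g(z | 1), g(z | -1))` of the two densities of the binary-input Gaussian
channel. -/
noncomputable def commonPDF (lam : ℝ) (z : ℝ) : ℝ :=
  ProbabilityTheory.gaussianPDFReal (-√(2 * lam)) 1 |z|

theorem commonPDF_nonneg (lam z : ℝ) : 0 ≤ commonPDF lam z :=
  ProbabilityTheory.gaussianPDFReal_nonneg _ _ _

theorem commonPDF_le (lam : ℝ) (b : ZMod 2) (z : ℝ) : commonPDF lam z ≤ biawgnPDF lam b z := by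
  unfold commonPDF biawgnPDF ProbabilityTheory.gaussianPDFReal
  have ha := Real.sqrt_nonneg (2 * lam)
  have habs : |bpsk b| = 1 := by
    unfold bpsk
    split_ifs <;> simp
  have h : (z - -bpsk b * √(2 * lam)) ^ 2 ≤ (|z| - -√(2 * lam)) ^ 2 := by
    rw [sq_le_sq]
    calc |z - -bpsk b * √(2 * lam)| = |z + bpsk b * √(2 * lam)| := by ring_nf
      _ ≤ |z| + |bpsk b * √(2 * lam)| := abs_add_le _ _
      _ = |z| - -√(2 * lam) := by rw [abs_mul, habs, abs_of_nonneg ha]; ring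
      _ ≤ _ := le_abs_self _
  gcongr

theorem integrable_biawgnPDF (lam : ℝ) (b : ZMod 2) : Integrable (biawgnPDF lam b) :=
  ProbabilityTheory.integrable_gaussianPDFReal _ _

theorem integrable_commonPDF (lam : ℝ) : Integrable (commonPDF lam) := by
  refine (integrable_biawgnPDF lam 0).mono' ?_ (ae_of_all _ fun z => ?_)
  · exact ((ProbabilityTheory.measurable_gaussianPDFReal _ _).comp
      measurable_norm).aestronglyMeasurable
  · rw [Real.norm_of_nonneg (commonPDF_nonneg lam z)]
    exact commonPDF_le lam 0 z

/-- The common part of the two densities has mass `2 Q(√(2 lam))`: this is the erasure rate of the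
erasure channel of which the Gaussian channel is a degraded version. -/
theorem integral_commonPDF (lam : ℝ) : ∫ z, commonPDF lam z = 2 * gaussQ √(2 * lam) := by
  unfold commonPDF gaussQ
  rw [integral_comp_abs (f := ProbabilityTheory.gaussianPDFReal (-√(2 * lam)) 1),
    ← integral_indicator measurableSet_Ioi, ← integral_indicator measurableSet_Ioi,
    ← integral_add_right_eq_self _ (-√(2 * lam))]
  congr 2
  ext z
  simp only [Set.indicator_apply, Set.mem_Ioi, ← sub_eq_add_neg, sub_pos,
    ProbabilityTheory.gaussianPDFReal]
  simp

/-- The densities that exhibit the binary-input Gaussian channel as a degraded erasure channel: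
an erasure carries the common part of the two densities of the channel, a bit that is not erased
carries the excess of its density over the common part. -/
noncomputable def degradedPDF (lam : ℝ) : Option (ZMod 2) → ℝ → ℝ
  | none, z => commonPDF lam z
  | some b, z => biawgnPDF lam b z - commonPDF lam z

theorem degradedPDF_nonneg (lam : ℝ) (o : Option (ZMod 2)) (z : ℝ) : 0 ≤ degradedPDF lam o z := by
  rcases o with _ | b
  · exact commonPDF_nonneg lam z
  · exact sub_nonneg.mpr (commonPDF_le lam b z)

theorem integrable_degradedPDF (lam : ℝ) (o : Option (ZMod 2)) :
    Integrable (degradedPDF lam o) := by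
  rcases o with _ | b
  · exact integrable_commonPDF lam
  · exact (integrable_biawgnPDF lam b).sub (integrable_commonPDF lam)

theorem integral_degradedPDF_none (lam : ℝ) :
    ∫ z, degradedPDF lam none z = 2 * gaussQ √(2 * lam) :=
  integral_commonPDF lam

theorem integral_degradedPDF_some (lam : ℝ) (b : ZMod 2) :
    ∫ z, degradedPDF lam (some b) z = 1 - 2 * gaussQ √(2 * lam) := by
  rw [← integral_commonPDF]
  unfold degradedPDF
  rw [integral_sub (integrable_biawgnPDF lam b) (integrable_commonPDF lam)]
  congr 1
  exact ProbabilityTheory.integral_gaussianPDFReal_eq_one _ one_ne_zero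

theorem gaussQ_nonneg (x : ℝ) : 0 ≤ gaussQ x :=
  integral_nonneg fun z => by positivity

theorem two_mul_gaussQ_le_one (lam : ℝ) : 2 * gaussQ √(2 * lam) ≤ 1 := by
  rw [← sub_nonneg, ← integral_degradedPDF_some lam 0]
  exact integral_nonneg fun z => degradedPDF_nonneg lam _ z

/-- The erasure-channel output `y` agrees with the word `x` at all positions not erased. -/
def Compatible {n : ℕ} (x : BinWord n) (y : Fin n → Option (ZMod 2)) : Prop :=
  ∀ i, y i = none ∨ y i = some (x i)

instance {n : ℕ} (x : BinWord n) (y : Fin n → Option (ZMod 2)) : Decidable (Compatible x y) :=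
  inferInstanceAs (Decidable (∀ i, y i = none ∨ y i = some (x i)))

/-- Expansion of the channel density along the outputs of the erasure channel. -/
theorem prod_biawgnPDF {n : ℕ} (lam : ℝ) (x : BinWord n) (z : Fin n → ℝ) :
    ∏ i, biawgnPDF lam (x i) (z i) = ∑ y : Fin n → Option (ZMod 2),
      (∏ i, degradedPDF lam (y i) (z i)) * if Compatible x y then 1 else 0 := by
  have h (b : ZMod 2) (t : ℝ) : biawgnPDF lam b t =
      ∑ o ∈ ({none, some b} : Finset (Option (ZMod 2))), degradedPDF lam o t := by
    rw [Finset.sum_pair (by simp)]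
    simp [degradedPDF]
  simp_rw [h, Finset.prod_univ_sum, mul_ite, mul_one, mul_zero]
  rw [← Finset.sum_filter]
  refine Finset.sum_congr ?_ fun _ _ => rfl
  ext y
  rw [Finset.mem_filter]
  simp [Compatible]

theorem measurable_massEntropy {α : Type*} [Fintype α] :
    Measurable (massEntropy : (α → ℝ) → ℝ) := by
  unfold massEntropy
  refine Measurable.mul (by fun_prop) (Finset.measurable_sum _ fun a _ => ?_)
  exact Real.continuous_negMulLog.measurable.comp (by fun_prop)

section Mixture

variable {Ω α κ : Type*} [MeasurableSpace Ω] [Fintype α] [Fintype κ] {μ : Measure Ω}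
  {h : κ → Ω → ℝ} {q : κ → α → ℝ}

theorem integrable_sum_mixture (hi : ∀ k, Integrable (h k) μ) :
    Integrable (fun z => ∑ a, ∑ k, h k z * q k a) μ :=
  integrable_finsetSum _ fun _ _ => integrable_finsetSum _ fun k _ => (hi k).mul_const _

theorem integrable_massEntropy_mixture (h0 : ∀ k z, 0 ≤ h k z) (hi : ∀ k, Integrable (h k) μ)
    (hq : ∀ k a, 0 ≤ q k a) : Integrable (fun z => massEntropy fun a => ∑ k, h k z * q k a) μ := by
  have hp (z : Ω) (a : α) : 0 ≤ ∑ k, h k z * q k a :=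
    Finset.sum_nonneg fun k _ => mul_nonneg (h0 k z) (hq k a)
  refine ((integrable_sum_mixture (q := q) hi).mul_const (Real.log (Fintype.card α))).mono' ?_
    (ae_of_all _ fun z => ?_)
  · refine (measurable_massEntropy.comp_aemeasurable
      (aemeasurable_pi_lambda _ fun a => ?_)).aestronglyMeasurable
    exact Finset.aemeasurable_fun_sum _ fun k _ => (hi k).aemeasurable.mul_const _
  · rw [Real.norm_of_nonneg (massEntropy_nonneg _ (hp z))]
    exact massEntropy_le _ (hp z)

/-- Revealing the mixture component to the observer can only decrease the equivocation. -/
theorem le_integral_massEntropy_mixture (h0 : ∀ k z, 0 ≤ h k z) (hi : ∀ k, Integrable (h k) μ)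
    (hq : ∀ k a, 0 ≤ q k a) :
    ∑ k, (∫ z, h k z ∂μ) * massEntropy (q k) ≤
      ∫ z, massEntropy (fun a => ∑ k, h k z * q k a) ∂μ := by
  simp_rw [← integral_mul_const]
  rw [← integral_finsetSum _ fun k _ => (hi k).mul_const _]
  exact integral_mono (integrable_finsetSum _ fun k _ => (hi k).mul_const _)
    (integrable_massEntropy_mixture h0 hi hq)
    fun z => sum_mul_massEntropy_le _ (fun k => h0 k z) _ hq

theorem integral_massEntropy_mixture_le (h0 : ∀ k z, 0 ≤ h k z) (hi : ∀ k, Integrable (h k) μ)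
    (hq : ∀ k a, 0 ≤ q k a) :
    ∫ z, massEntropy (fun a => ∑ k, h k z * q k a) ∂μ ≤
      (∑ k, (∫ z, h k z ∂μ) * ∑ a, q k a) * Real.log (Fintype.card α) := by
  have hs : ∑ k, (∫ z, h k z ∂μ) * ∑ a, q k a = ∫ z, ∑ a, ∑ k, h k z * q k a ∂μ := by
    rw [integral_finsetSum _ fun _ _ => integrable_finsetSum _ fun k _ => (hi k).mul_const _]
    simp_rw [integral_finsetSum _ fun k _ => (hi k).mul_const _, integral_mul_const, Finset.mul_sum]
    exact Finset.sum_comm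
  rw [hs, ← integral_mul_const]
  exact integral_mono (integrable_massEntropy_mixture h0 hi hq)
    ((integrable_sum_mixture (q := q) hi).mul_const _)
    fun z => massEntropy_le _ fun a => Finset.sum_nonneg fun k _ => mul_nonneg (h0 k z) (hq k a)

end Mixture

/-! ### Cosets of the dual code -/

theorem card_filter_sub_mem {n : ℕ} (E : BinCode n) [DecidablePred (· ∈ E)] (x₀ : BinWord n) :
    (Finset.univ.filter fun x => x - x₀ ∈ E).card = 2 ^ Module.finrank (ZMod 2) E := by
  have h : (Finset.univ.filter fun x => x - x₀ ∈ E).card = Fintype.card E := by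
    rw [Fintype.card_subtype]
    refine Finset.card_bij (fun x _ => x - x₀) (fun x hx => by simpa using hx)
      (fun x _ y _ hxy => sub_left_injective hxy) fun y hy => ⟨y + x₀, by simpa using hy, by simp⟩
  rw [h, Module.card_eq_pow_finrank (K := ZMod 2), ZMod.card]

theorem mem_cosetWords_top_iff {n : ℕ} (D : BinCode n)
    (w : (⊤ : BinCode n) ⧸ D.submoduleOf ⊤) {x₀ : BinWord n} (h₀ : x₀ ∈ cosetWords ⊤ D w)
    (x : BinWord n) : x ∈ cosetWords ⊤ D w ↔ x - x₀ ∈ D := by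
  simp only [cosetWords, Finset.mem_filter, Finset.mem_univ, true_and, Submodule.mem_top,
    exists_true_left] at h₀ ⊢
  rw [← h₀, Submodule.mkQ_apply, Submodule.mkQ_apply, Submodule.Quotient.eq]
  rfl

theorem card_cosetWords_top {n : ℕ} (D : BinCode n) (w : (⊤ : BinCode n) ⧸ D.submoduleOf ⊤) :
    (cosetWords ⊤ D w).card = 2 ^ Module.finrank (ZMod 2) D := by
  classical
  obtain ⟨x₀, h₀⟩ := cosetWords_nonempty ⊤ D w
  rw [← card_filter_sub_mem D x₀]
  congr 1
  ext x
  simp [mem_cosetWords_top_iff D w h₀]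

theorem finrank_top_quotient {n : ℕ} (D : BinCode n) :
    Module.finrank (ZMod 2) ((⊤ : BinCode n) ⧸ D.submoduleOf ⊤) + Module.finrank (ZMod 2) D = n := by
  have h := Submodule.finrank_quotient_add_finrank (D.submoduleOf ⊤)
  rw [(Submodule.submoduleOfEquivOfLe (le_top : D ≤ ⊤)).finrank_eq, finrank_top,
    Module.finrank_fin_fun] at h
  exact h

theorem card_msg {n : ℕ} (C : BinCode n) :
    Fintype.card (secureNestedCode ⊤ (dualCode C) le_top).Msg =
      2 ^ Module.finrank (ZMod 2) C := by
  have h : Module.finrank (ZMod 2) ((⊤ : BinCode n) ⧸ (dualCode C).submoduleOf ⊤) =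
      Module.finrank (ZMod 2) C := by
    have h1 := finrank_top_quotient (dualCode C)
    have h2 := finrank_dualCode C
    omega
  rw [← h, Fintype.card_eq_nat_card]
  change Nat.card ((⊤ : BinCode n) ⧸ (dualCode C).submoduleOf ⊤) = _
  rw [Module.natCard_eq_pow_finrank (K := ZMod 2), Nat.card_zmod]

theorem rate_secureNestedCode {n : ℕ} (C : BinCode n) :
    (secureNestedCode ⊤ (dualCode C) le_top).rate = codeRate C := by
  rw [WiretapCode.rate, card_msg, codeRate, Nat.cast_pow, Nat.cast_ofNat, Real.logb_pow,
    Real.logb_self_eq_one one_lt_two, mul_one]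

theorem toReal_enc {n : ℕ} (C₀ C₁ : BinCode n) (h : C₁ ≤ C₀)
    (w : C₀ ⧸ C₁.submoduleOf C₀) (x : BinWord n) :
    ((secureNestedCode C₀ C₁ h).enc w x).toReal =
      if x ∈ cosetWords C₀ C₁ w then ((cosetWords C₀ C₁ w).card : ℝ)⁻¹ else 0 := by
  change (PMF.uniformOfFinset (cosetWords C₀ C₁ w) (cosetWords_nonempty C₀ C₁ w) x).toReal = _
  rw [PMF.uniformOfFinset_apply]
  split_ifs <;> simp

theorem errorProb_secureNestedCode {n : ℕ} (C₀ C₁ : BinCode n) (h : C₁ ≤ C₀) :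
    (secureNestedCode C₀ C₁ h).errorProb = 0 := by
  classical
  rw [WiretapCode.errorProb, Finset.sum_eq_zero, zero_div]
  intro w _
  refine Finset.sum_eq_zero fun x _ => ?_
  have henc := toReal_enc C₀ C₁ h w x
  by_cases hx : x ∈ cosetWords C₀ C₁ w
  · obtain ⟨hx0, hw⟩ := (Finset.mem_filter.mp hx).2
    have hd : (secureNestedCode C₀ C₁ h).dec x = w := by
      change (if h : x ∈ C₀ then (C₁.submoduleOf C₀).mkQ ⟨x, h⟩ else 0) = w
      rw [dif_pos hx0, hw]
    rw [if_pos hd, mul_zero]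
  · rw [if_neg hx] at henc
    exact mul_eq_zero_of_left henc _

/-- The probability that the transmitted word, uniformly distributed, lies in the coset `w` of `D`
and is compatible with the erasure-channel output `y`. -/
noncomputable def cosetMass {n : ℕ} (D : BinCode n) (y : Fin n → Option (ZMod 2))
    (w : (⊤ : BinCode n) ⧸ D.submoduleOf ⊤) : ℝ :=
  ((cosetWords ⊤ D w).filter fun x => Compatible x y).card / 2 ^ n

theorem cosetMass_nonneg {n : ℕ} (D : BinCode n) (y : Fin n → Option (ZMod 2))
    (w : (⊤ : BinCode n) ⧸ D.submoduleOf ⊤) : 0 ≤ cosetMass D y w := by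
  unfold cosetMass
  positivity

/-- A given output of the erasure channel is compatible with the fraction `2 ^ (-m)` of all words,
where `m` is the number of positions not erased. -/
theorem sum_cosetMass {n : ℕ} (D : BinCode n) [Fintype ((⊤ : BinCode n) ⧸ D.submoduleOf ⊤)]
    (y : Fin n → Option (ZMod 2)) :
    ∑ w, cosetMass D y w = ∏ i, if (y i).isSome then (1 / 2 : ℝ) else 1 := by
  classical
  have h1 : ∑ w, ((cosetWords ⊤ D w).filter fun x => Compatible x y).card =
      (Finset.univ.filter fun x : BinWord n => Compatible x y).card := by
    rw [Finset.card_eq_sum_card_fiberwise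
      (f := fun x : BinWord n => (D.submoduleOf ⊤).mkQ ⟨x, Submodule.mem_top⟩)
      (t := Finset.univ) (by simp)]
    refine Finset.sum_congr rfl fun w _ => congrArg _ ?_
    ext x
    rw [Finset.mem_filter, Finset.mem_filter, Finset.mem_filter, cosetWords, Finset.mem_filter]
    simp [and_comm]
  have h2 : (Finset.univ.filter fun x : BinWord n => Compatible x y) =
      Fintype.piFinset fun i => Finset.univ.filter fun b => y i = none ∨ y i = some b := by
    ext x
    rw [Finset.mem_filter]
    simp [Compatible]
  simp_rw [cosetMass]
  rw [← Finset.sum_div, ← Nat.cast_sum, h1, h2, Fintype.card_piFinset, Nat.cast_prod,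
    show (2 : ℝ) ^ n = ∏ _i : Fin n, 2 by simp, ← Finset.prod_div_distrib]
  refine Finset.prod_congr rfl fun i _ => ?_
  rcases y i with _ | b
  · simp [ZMod.card]
  · simp [Finset.filter_eq]

/-- The positions that are not erased in `y`. -/
def known {n : ℕ} (y : Fin n → Option (ZMod 2)) : Fin n → Bool := fun i => (y i).isSome

/-- Given an erasure-channel output, no coset of the dual code has posterior probability above
`2 ^ (d - k)`, where `k` is the dimension of `C` and `d` that of the space of codewords supported
on the positions not erased. -/
theorem cosetMass_dualCode_le {n : ℕ} (C : BinCode n)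
    [Fintype ((⊤ : BinCode n) ⧸ (dualCode C).submoduleOf ⊤)]
    (y : Fin n → Option (ZMod 2)) (w : (⊤ : BinCode n) ⧸ (dualCode C).submoduleOf ⊤) :
    cosetMass (dualCode C) y w ≤ (∑ w, cosetMass (dualCode C) y w) *
      Real.exp (-(((Module.finrank (ZMod 2) C : ℝ) -
        Module.finrank (ZMod 2) (shortened C (known y))) * Real.log 2)) := by
  classical
  set k := Module.finrank (ZMod 2) C
  set d := Module.finrank (ZMod 2) (shortened C (known y))
  set e := Module.finrank (ZMod 2) (shortened (dualCode C) (fun i => !known y i))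
  set m := (Finset.univ.filter fun i => known y i = true).card
  have hdim : e + k + m ≤ n + d := finrank_shortened_dualCode_le C (known y)
  have hcard : ((cosetWords ⊤ (dualCode C) w).filter fun x => Compatible x y).card ≤ 2 ^ e := by
    rcases ((cosetWords ⊤ (dualCode C) w).filter fun x => Compatible x y).eq_empty_or_nonempty
      with h | ⟨x₀, h₀⟩
    · simp [h]
    rw [Finset.mem_filter] at h₀
    rw [← card_filter_sub_mem _ x₀]
    refine Finset.card_le_card fun x hx => ?_
    rw [Finset.mem_filter] at hx
    rw [Finset.mem_filter]
    refine ⟨Finset.mem_univ _, (mem_cosetWords_top_iff _ w h₀.1 x).mp hx.1, fun i hi => ?_⟩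
    have hsome : (y i).isSome := by simpa [known] using hi
    obtain ⟨b, hb⟩ := Option.isSome_iff_exists.mp hsome
    have h1 := h₀.2 i
    have h2 := hx.2 i
    simp only [hb, reduceCtorEq, Option.some.injEq, false_or] at h1 h2
    rw [Pi.sub_apply, ← h1, ← h2, sub_self]
  have hsum : ∑ w, cosetMass (dualCode C) y w = 1 / 2 ^ m := by
    rw [sum_cosetMass, Finset.prod_ite, Finset.prod_const, Finset.prod_const_one, mul_one,
      one_div_pow]
    rfl
  have hexp : Real.exp (-(((k : ℝ) - d) * Real.log 2)) = 2 ^ d / 2 ^ k := by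
    rw [show -(((k : ℝ) - d) * Real.log 2) = d * Real.log 2 - k * Real.log 2 by ring,
      Real.exp_sub, Real.exp_nat_mul, Real.exp_nat_mul, Real.exp_log two_pos]
  rw [hsum, hexp, cosetMass, div_mul_div_comm, one_mul, ← pow_add,
    div_le_div_iff₀ (by positivity) (by positivity)]
  calc (((cosetWords ⊤ (dualCode C) w).filter fun x => Compatible x y).card : ℝ) * 2 ^ (m + k)
      ≤ 2 ^ e * 2 ^ (m + k) := by gcongr; exact_mod_cast hcard
    _ = 2 ^ (e + k + m) := by rw [← pow_add]; congr 1; omega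
    _ ≤ 2 ^ (n + d) := pow_le_pow_right₀ one_le_two hdim
    _ = _ := by rw [pow_add, mul_comm]

/-- The joint density of the message and the eavesdropper's observation is a mixture, over the outputs
of the erasure channel, of densities that do not depend on the message. -/
theorem eavesPDF_eq_mixture {n : ℕ} (C : BinCode n) (lam : ℝ)
    (w : (⊤ : BinCode n) ⧸ (dualCode C).submoduleOf ⊤) (z : Fin n → ℝ) :
    1 / (Fintype.card (secureNestedCode ⊤ (dualCode C) le_top).Msg : ℝ) *
      (secureNestedCode ⊤ (dualCode C) le_top).eavesPDF lam w z =
      ∑ y : Fin n → Option (ZMod 2),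
        (∏ i, degradedPDF lam (y i) (z i)) * cosetMass (dualCode C) y w := by
  classical
  have henc : (secureNestedCode ⊤ (dualCode C) le_top).eavesPDF lam w z =
      ∑ x : BinWord n, (if x ∈ cosetWords ⊤ (dualCode C) w then
        ((cosetWords ⊤ (dualCode C) w).card : ℝ)⁻¹ else 0) * ∏ i, biawgnPDF lam (x i) (z i) :=
    Finset.sum_congr rfl fun x _ => congrArg (· * ∏ i, biawgnPDF lam (x i) (z i))
      (toReal_enc ⊤ (dualCode C) le_top w x)
  rw [henc, Finset.mul_sum]
  have hx (x : BinWord n) : 1 / (Fintype.card (secureNestedCode ⊤ (dualCode C) le_top).Msg : ℝ) *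
      ((if x ∈ cosetWords ⊤ (dualCode C) w then
        ((cosetWords ⊤ (dualCode C) w).card : ℝ)⁻¹ else 0) * ∏ i, biawgnPDF lam (x i) (z i)) =
      ∑ y : Fin n → Option (ZMod 2), (∏ i, degradedPDF lam (y i) (z i)) *
        ((if x ∈ cosetWords ⊤ (dualCode C) w ∧ Compatible x y then 1 else 0) / 2 ^ n) := by
    rw [card_cosetWords_top, prod_biawgnPDF, card_msg, ← mul_assoc, Finset.mul_sum]
    refine Finset.sum_congr rfl fun y _ => ?_
    by_cases h1 : x ∈ cosetWords ⊤ (dualCode C) w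
    · by_cases h2 : Compatible x y
      · simp only [h1, h2, if_true, and_self]
        rw [show (2 : ℝ) ^ n = 2 ^ Module.finrank (ZMod 2) C *
          2 ^ Module.finrank (ZMod 2) (dualCode C) by rw [← pow_add, finrank_dualCode]]
        push_cast
        field_simp
      · simp [h2]
    · simp [h1]
  simp_rw [hx]
  rw [Finset.sum_comm]
  refine Finset.sum_congr rfl fun y _ => ?_
  rw [← Finset.mul_sum, ← Finset.sum_div]
  unfold cosetMass
  congr 2
  rw [Finset.sum_boole, Finset.filter_and]
  congr 2
  ext x
  simp

/-! ### The equivocation -/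

theorem equivocation_eq_integral {n : ℕ} (C : BinCode n) (lam : ℝ) :
    (secureNestedCode ⊤ (dualCode C) le_top).equivocation lam =
      (∫ z : Fin n → ℝ, massEntropy fun w : (secureNestedCode ⊤ (dualCode C) le_top).Msg =>
        ∑ y : Fin n → Option (ZMod 2),
          (∏ i, degradedPDF lam (y i) (z i)) * cosetMass (dualCode C) y w) / Real.log 2 := by
  have h (w : (secureNestedCode ⊤ (dualCode C) le_top).Msg) (z : Fin n → ℝ) :=
    eavesPDF_eq_mixture C lam w z
  rw [WiretapCode.equivocation, condEntropyBits, ← integral_div]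
  simp_rw [h, massEntropy, mul_div_assoc]

theorem integrable_prod_degradedPDF {n : ℕ} (lam : ℝ) (y : Fin n → Option (ZMod 2)) :
    Integrable fun z : Fin n → ℝ => ∏ i, degradedPDF lam (y i) (z i) :=
  Integrable.fintype_prod_dep fun i => integrable_degradedPDF lam (y i)

theorem integral_prod_degradedPDF_mul {n : ℕ} (lam : ℝ) (y : Fin n → Option (ZMod 2)) :
    (∫ z : Fin n → ℝ, ∏ i, degradedPDF lam (y i) (z i)) *
      (∏ i, if (y i).isSome then (1 / 2 : ℝ) else 1) =
    ∏ i, match y i with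
      | none => 2 * gaussQ √(2 * lam)
      | some _ => (1 - 2 * gaussQ √(2 * lam)) / 2 := by
  rw [integral_fintype_prod_volume_eq_prod (fun i t => degradedPDF lam (y i) t),
    ← Finset.prod_mul_distrib]
  refine Finset.prod_congr rfl fun i _ => ?_
  rcases y i with _ | b
  · simp [integral_degradedPDF_none]
  · simp [integral_degradedPDF_some, div_eq_mul_inv]

/-- Averaged over the transmitted word, the positions not erased form a random set that includes every
position with probability `1 - 2 Q(√(2 lam))` independently. -/
theorem sum_integral_prod_degradedPDF_mul {n : ℕ} (lam : ℝ) (g : (Fin n → Bool) → ℝ) :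
    ∑ y : Fin n → Option (ZMod 2), (∫ z : Fin n → ℝ, ∏ i, degradedPDF lam (y i) (z i)) *
      ((∏ i, if (y i).isSome then (1 / 2 : ℝ) else 1) * g (known y)) =
    ∑ s : Fin n → Bool, (∏ i, bernWeight (1 - 2 * gaussQ √(2 * lam)) (s i)) * g s := by
  simp_rw [← mul_assoc, integral_prod_degradedPDF_mul]
  have h := sum_prod_mul_comp (fun (_ : Fin n) (o : Option (ZMod 2)) => match o with
      | none => 2 * gaussQ √(2 * lam)
      | some _ => (1 - 2 * gaussQ √(2 * lam)) / 2) (fun _ => Option.isSome) g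
  refine h.trans (Finset.sum_congr rfl fun s _ => ?_)
  congr 1
  refine Finset.prod_congr rfl fun i _ => ?_
  rw [Finset.sum_filter, Fintype.sum_option]
  cases s i
  · simp [bernWeight]
  · simp [bernWeight, ZMod.card]
    ring

/-- The eavesdropper lacks at least the bits of the message that remain uncertain after the better
erasure channel; their mean number is `k` minus the mean ambiguity of `C` at the *complementary*
erasure rate `1 - 2 Q(√(2 lam))`. -/
theorem le_equivocation {n : ℕ} (C : BinCode n) (lam : ℝ) :
    Module.finrank (ZMod 2) C - meanAmbiguity C (1 - 2 * gaussQ √(2 * lam)) ≤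
      (secureNestedCode ⊤ (dualCode C) le_top).equivocation lam := by
  have hlog : 0 < Real.log 2 := Real.log_pos one_lt_two
  rw [equivocation_eq_integral, le_div_iff₀ hlog]
  let _ : Fintype ((⊤ : BinCode n) ⧸ (dualCode C).submoduleOf ⊤) :=
    (secureNestedCode ⊤ (dualCode C) le_top).fintypeMsg
  refine le_trans ?_ (le_integral_massEntropy_mixture
    (fun y z => Finset.prod_nonneg fun i _ => degradedPDF_nonneg lam (y i) (z i))
    (integrable_prod_degradedPDF lam) (cosetMass_nonneg (dualCode C)))
  set k := Module.finrank (ZMod 2) C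
  calc ((k : ℝ) - meanAmbiguity C (1 - 2 * gaussQ √(2 * lam))) * Real.log 2
      = ∑ s : Fin n → Bool, (∏ i, bernWeight (1 - 2 * gaussQ √(2 * lam)) (s i)) *
          (((k : ℝ) - Module.finrank (ZMod 2) (shortened C s)) * Real.log 2) := by
        simp_rw [← mul_assoc, mul_sub]
        rw [← Finset.sum_mul, Finset.sum_sub_distrib, ← Finset.sum_mul, sum_prod_bernWeight,
          one_mul]
        rfl
    _ = ∑ y : Fin n → Option (ZMod 2), (∫ z : Fin n → ℝ, ∏ i, degradedPDF lam (y i) (z i)) *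
          ((∑ w, cosetMass (dualCode C) y w) *
            (((k : ℝ) - Module.finrank (ZMod 2) (shortened C (known y))) * Real.log 2)) := by
        simp_rw [sum_cosetMass]
        exact (sum_integral_prod_degradedPDF_mul lam _).symm
    _ ≤ _ := by
        refine Finset.sum_le_sum fun y _ => mul_le_mul_of_nonneg_left ?_ ?_
        · exact mul_le_massEntropy _ (cosetMass_nonneg _ y) _ (cosetMass_dualCode_le C y)
        · exact integral_nonneg fun z => Finset.prod_nonneg fun i _ => degradedPDF_nonneg lam _ _

theorem equivocation_le {n : ℕ} (C : BinCode n) (lam : ℝ) :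
    (secureNestedCode ⊤ (dualCode C) le_top).equivocation lam ≤ Module.finrank (ZMod 2) C := by
  have hlog : 0 < Real.log 2 := Real.log_pos one_lt_two
  rw [equivocation_eq_integral, div_le_iff₀ hlog]
  let _ : Fintype ((⊤ : BinCode n) ⧸ (dualCode C).submoduleOf ⊤) :=
    (secureNestedCode ⊤ (dualCode C) le_top).fintypeMsg
  refine (integral_massEntropy_mixture_le
    (fun y z => Finset.prod_nonneg fun i _ => degradedPDF_nonneg lam (y i) (z i))
    (integrable_prod_degradedPDF lam) (cosetMass_nonneg (dualCode C))).trans_eq ?_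
  have h1 : Fintype.card ((⊤ : BinCode n) ⧸ (dualCode C).submoduleOf ⊤) =
      2 ^ Module.finrank (ZMod 2) C := card_msg C
  have h2 := sum_integral_prod_degradedPDF_mul (n := n) lam fun _ => 1
  simp_rw [mul_one, sum_prod_bernWeight] at h2
  simp_rw [sum_cosetMass]
  rw [h1, h2, one_mul, Nat.cast_pow, Nat.cast_ofNat, Real.log_pow]

/-- At every erasure rate up to the threshold the mean ambiguity grows sublinearly. -/
theorem tendsto_meanAmbiguity_div {N : ℕ → ℕ} (crit : ErrorCriterion) (C : ∀ j, BinCode (N j))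
    (D : ℝ → ∀ j, BECDecoder (N j)) {δs p : ℝ} (hδs : IsErasureThreshold crit C D δs)
    (h0 : 0 ≤ p) (h1 : p ≤ 1) (hp : p ≤ δs) :
    Tendsto (fun j => meanAmbiguity (C j) p / N j) atTop (𝓝 0) := by
  rw [tendsto_order]
  refine ⟨fun a ha => Eventually.of_forall fun j =>
    ha.trans_le (div_nonneg (meanAmbiguity_nonneg _ h0 h1) (Nat.cast_nonneg _)), fun ε hε => ?_⟩
  obtain ⟨δ, ⟨⟨hδ0, hδ1⟩, hδ⟩, hlt, -⟩ :=
    hδs.exists_between (show δs - ε / 2 < δs by linarith)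
  filter_upwards [hδ.eventually_lt_const (show (0 : ℝ) < ε / 4 by linarith)] with j hj
  have hA := meanAmbiguity_le (C j) h0 h1 hδ0 hδ1
  have hB := meanAmbiguity_div_le_becErrorProb crit (C j) (D δ j) hδ0 hδ1
  have hmax : max (p - δ) 0 < ε / 2 := max_lt (by linarith) (by linarith)
  calc meanAmbiguity (C j) p / N j
      ≤ (meanAmbiguity (C j) δ + N j * max (p - δ) 0) / N j := by gcongr
    _ = meanAmbiguity (C j) δ / N j + (N j / N j : ℝ) * max (p - δ) 0 := by ring
    _ ≤ meanAmbiguity (C j) δ / N j + 1 * max (p - δ) 0 := by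
        gcongr
        exact div_self_le_one _
    _ < ε := by linarith

end Wiretap

theorem theorem2 (N : ℕ → ℕ) (hN : Filter.Tendsto N Filter.atTop Filter.atTop)
    (C : ∀ j, Wiretap.BinCode (N j)) (Rc : ℝ)
    (hRc : Filter.Tendsto (fun j => Wiretap.codeRate (C j)) Filter.atTop (nhds Rc))
    (crit : Wiretap.ErrorCriterion) (D : ℝ → ∀ j, Wiretap.BECDecoder (N j)) (δs : ℝ)
    (hδs : Wiretap.IsErasureThreshold crit C D δs)
    (lam : ℝ) (hlam : 0 ≤ lam)
    (hQ : Wiretap.gaussQ (√(2 * lam)) ≥ (1 - δs) / 2) :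
    (∀ j, (Wiretap.secureNestedCode ⊤ (Wiretap.dualCode (C j)) le_top).rate =
      Wiretap.codeRate (C j)) ∧
    Wiretap.AchievesPair
      (fun j => Wiretap.secureNestedCode ⊤ (Wiretap.dualCode (C j)) le_top) lam Rc Rc := by
  refine ⟨fun j => Wiretap.rate_secureNestedCode (C j), hN, ?_, ?_, Rc, ?_, le_rfl⟩
  · simpa only [Wiretap.rate_secureNestedCode] using hRc
  · simpa only [Wiretap.errorProb_secureNestedCode] using tendsto_const_nhds
  · have hamb := Wiretap.tendsto_meanAmbiguity_div crit C D hδs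
      (p := 1 - 2 * Wiretap.gaussQ √(2 * lam))
      (sub_nonneg.mpr (Wiretap.two_mul_gaussQ_le_one lam))
      (by linarith [Wiretap.gaussQ_nonneg √(2 * lam)]) (by linarith)
    have hlow := hRc.sub hamb
    rw [sub_zero] at hlow
    refine tendsto_of_tendsto_of_tendsto_of_le_of_le hlow hRc (fun j => ?_) fun j => ?_
    · simp only [Wiretap.codeRate, ← sub_div]
      exact div_le_div_of_nonneg_right (Wiretap.le_equivocation (C j) lam) (Nat.cast_nonneg _)
    · exact div_le_div_of_nonneg_right (Wiretap.equivocation_le (C j) lam) (Nat.cast_nonneg _)
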